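/- Let $H=(V,E)$ be a finite connected hypergraph without repeated hyperedges, with at least one hyperedge, all of whose hyperedges have at least two vertices. Let $m=\max\{|e|:e\in E\}$ be its rank, and let $s=s(H)=\operatorname{lcm}\{|e|-1 : e\in E\}$. For $i\in V$ let $E_k(i)$ be the set of hyperedges with $k$ elements that contain $i$. Let $\mathcal A_H=(a_{i_1i_2\cdots i_{s+1}})$ be the adjacency tensor of order $s+1$ indexed by $V$: if for some $e\in E$ with $|e|=k$ we have $i_1\in e$ and the multiset $\{i_2,\dots,i_{s+1}\}$ consists of the elements of $e\setminus\{i_1\}$, each taken exactly $\frac{s}{k-1}$ times, then $a_{i_1\cdots i_{s+1}}=\frac{[(\frac{s}{k-1})!]^{k-1}}{s!}$; all other entries are $0$. Write $(\mathcal A_H x^{s})_i=\sum_{i_2,\dots,i_{s+1}\in V}a_{ii_2\cdots i_{s+1}}x_{i_2}\cdots x_{i_{s+1}}$ and $x^{[s]}=(x_i^s)_{i\in V}$. An eigenvalue of $\mathcal A_H$ is a $\mu\in\mathbb C$ with $\mathcal A_H x^{s}=\mu x^{[s]}$ for some nonzero $x\in\mathbb C^V$, and $\rho(\mathcal A_H)$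 is the largest modulus of an eigenvalue. Then this maximum exists and $\rho(\mathcal A_H)>0$, and for $\lambda=\rho(\mathcal A_H)$ the system $$y_i^{s}=\frac1\lambda\sum_{k=2}^{m}\ \sum_{e\in E_k(i)}\Bigl(\prod_{j\in e\setminus\{i\}}y_j\Bigr)^{\frac{s}{k-1}}\qquad(i\in V)$$ has a solution $y\in\mathbb R^V$ with all $y_i>0$, and the solutions with positive entries are exactly the vectors $cy$ with $c>0$. For $y\in\mathbb R^V$, this system is equivalent to the eigenvector equation $\mathcal A_H y^{s}=\rho(\mathcal A_H)\,y^{[s]}$. In particular there is exactly one vector $y$ with positive entries that satisfies $\mathcal A_H y^{s}=\rho(\mathcal A_H)\,y^{[s]}$ and $\|y\|_{s+1}=1$ (the hypergraph eigenvector centrality of $H$). -/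

import Mathlib

namespace RealTensor

/-- For a tensor `A` of order `d + 1` indexed by `V`, the vector `A x ^ d`, whose `i`-th component
is `∑ A (i, i₂, …, i_{d+1}) * x i₂ * ⋯ * x i_{d+1}` over all `i₂, …, i_{d+1}`. -/
def apply {V R : Type*} [Fintype V] [CommSemiring R] {d : ℕ}
    (A : (Fin (d + 1) → V) → R) (x : V → R) (i : V) : R :=
  ∑ f : Fin d → V, A (Fin.cons i f) * ∏ t, x (f t)

/-- The (complex) eigenvalues of a real tensor `A` of order `d + 1`: the `μ` such that
`A x ^ d = μ x ^ [d]` for some nonzero complex vector `x`. -/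
def eigenvalues {V : Type*} [Fintype V] {d : ℕ} (A : (Fin (d + 1) → V) → ℝ) : Set ℂ :=
  {μ | ∃ x : V → ℂ, x ≠ 0 ∧ ∀ i, apply (fun f => (A f : ℂ)) x i = μ * x i ^ d}

/-- The set `{|μ| : μ an eigenvalue of A}`. -/
def eigenvalueModuli {V : Type*} [Fintype V] {d : ℕ} (A : (Fin (d + 1) → V) → ℝ) : Set ℝ :=
  (fun μ : ℂ => ‖μ‖) '' eigenvalues A

/-- The spectral radius: the largest modulus of an eigenvalue (the supremum is used here; that it
is attained is asserted where the spectral radius is used). -/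
noncomputable def spectralRadius {V : Type*} [Fintype V] {d : ℕ}
    (A : (Fin (d + 1) → V) → ℝ) : ℝ :=
  sSup (eigenvalueModuli A)

end RealTensor

namespace Hypergraph

/-- Any two vertices are joined by a path `i₁ e₁ i₂ e₂ ⋯ e_r i_{r+1}`, where the hyperedge `e_t`
contains `i_t` and `i_{t+1}`; there is at least one vertex. -/
def IsConnected {V : Type*} (H : Hypergraph V) : Prop :=
  H.vertexSet.Nonempty ∧
    ∀ i ∈ H.vertexSet, ∀ j ∈ H.vertexSet, Relation.ReflTransGen H.Adj i j

open Classical in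
/-- The hyperedges, as a finset of finsets (the vertex type is finite). -/
noncomputable def edges {V : Type*} [Fintype V] (H : Hypergraph V) : Finset (Finset V) :=
  Finset.univ.filter fun e => (e : Set V) ∈ H.edgeSet

/-- The rank: the maximum cardinality of a hyperedge. -/
noncomputable def rank {V : Type*} [Fintype V] (H : Hypergraph V) : ℕ :=
  H.edges.sup Finset.card

/-- `E_k(i)`: the hyperedges of cardinality `k` that contain `i`. -/
noncomputable def edgesAt {V : Type*} [Fintype V] [DecidableEq V] (H : Hypergraph V)
    (k : ℕ) (i : V) : Finset (Finset V) :=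
  H.edges.filter fun e => e.card = k ∧ i ∈ e

/-- The set of the cardinalities of all hyperedges. -/
noncomputable def cardinalitySet {V : Type*} [Fintype V] (H : Hypergraph V) : Finset ℕ :=
  H.edges.image Finset.card

/-- `s(H) = lcm (l₁ - 1, …, l_r - 1)`, where `{l₁, …, l_r}` is the cardinality set of `H`. -/
noncomputable def s {V : Type*} [Fintype V] (H : Hypergraph V) : ℕ :=
  H.cardinalitySet.lcm fun l => l - 1

/-- `i₁ i₂ ⋯ i_{s+1}` is an index sequence of the set `e` of cardinality `k`: `i₁ ∈ e`, and the
multiset `{i₂, …, i_{s+1}}` consists of the elements of `e \ {i₁}`, each `s / (k - 1)` times. -/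
def IsIndexSeq {V : Type*} [DecidableEq V] {s : ℕ} (e : Finset V) (f : Fin (s + 1) → V) : Prop :=
  f 0 ∈ e ∧
    (Finset.univ : Finset (Fin s)).val.map (fun t => f t.succ) =
      (s / (e.card - 1)) • (e.erase (f 0)).val

open Classical in
/-- The adjacency tensor, of order `s(H) + 1`. The entry at an index sequence of a hyperedge with
`k` elements is `((s / (k - 1))!) ^ (k - 1) / s!`; all other entries are `0`.
A sequence belongs to at most one hyperedge, so the sum has at most one nonzero term (see
`adjacencyTensor_eq` and `adjacencyTensor_eq_zero`). -/
noncomputable def adjacencyTensor {V : Type*} [Fintype V] [DecidableEq V] (H : Hypergraph V) :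
    (Fin (H.s + 1) → V) → ℝ :=
  fun f => ∑ e ∈ H.edges,
    if IsIndexSeq e f then
      ((Nat.factorial (H.s / (e.card - 1)) : ℝ) ^ (e.card - 1)) / (Nat.factorial H.s : ℝ)
    else 0

/-- The centrality equation with parameter `lam`:
`y_i ^ s = (1 / lam) * ∑_{k = 2}^{m} ∑_{e ∈ E_k(i)} (∏_{j ∈ e \ {i}} y_j) ^ (s / (k - 1))` for all
vertices `i`, where `m` is the rank and `s = s(H)`. The divisions `s / (k - 1)` are exact. -/
def CentralityEq {V : Type*} [Fintype V] [DecidableEq V] (H : Hypergraph V)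
    (lam : ℝ) (y : V → ℝ) : Prop :=
  ∀ i, y i ^ H.s = 1 / lam *
    ∑ k ∈ Finset.Icc 2 H.rank, ∑ e ∈ H.edgesAt k i, (∏ j ∈ e.erase i, y j) ^ (H.s / (k - 1))

/-- The tensor eigenvector equation `A_H y ^ s = lam y ^ [s]`. -/
def TensorEigenEq {V : Type*} [Fintype V] [DecidableEq V] (H : Hypergraph V)
    (lam : ℝ) (y : V → ℝ) : Prop :=
  ∀ i, RealTensor.apply H.adjacencyTensor y i = lam * y i ^ H.s

/-- `y` is the hypergraph eigenvector centrality of `H`: a positive solution of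
`A_H y ^ s = ρ(A_H) y ^ [s]` whose `ℓ^(s+1)`-norm is `1`. -/
def IsHEC {V : Type*} [Fintype V] [DecidableEq V] (H : Hypergraph V) (y : V → ℝ) : Prop :=
  (∀ i, 0 < y i) ∧
    H.TensorEigenEq (RealTensor.spectralRadius H.adjacencyTensor) y ∧
    (∑ i, |y i| ^ (H.s + 1)) ^ (1 / ((H.s : ℝ) + 1)) = 1

theorem mem_edges {V : Type*} [Fintype V] (H : Hypergraph V) (e : Finset V) :
    e ∈ H.edges ↔ (e : Set V) ∈ H.edgeSet := by
  simp [edges]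

theorem dvd_s {V : Type*} [Fintype V] (H : Hypergraph V) {e : Finset V} (he : e ∈ H.edges) :
    e.card - 1 ∣ H.s :=
  Finset.dvd_lcm (f := fun l => l - 1) (Finset.mem_image_of_mem _ he)

theorem s_pos {V : Type*} [Fintype V] (H : Hypergraph V)
    (hcard : ∀ e ∈ H.edges, 2 ≤ e.card) : 0 < H.s := by
  refine Nat.pos_of_ne_zero fun h => ?_
  obtain ⟨l, hl, h0⟩ := Finset.lcm_eq_zero_iff.mp h
  obtain ⟨e, he, rfl⟩ := Finset.mem_image.mp hl
  have := hcard e he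
  omega

theorem IsIndexSeq.eq_image {V : Type*} [DecidableEq V] {s : ℕ} {e : Finset V}
    {f : Fin (s + 1) → V} (h : IsIndexSeq e f) (hs : s / (e.card - 1) ≠ 0) :
    e = Finset.univ.image f := by
  obtain ⟨h0, h1⟩ := h
  have key : ∀ v, (∃ t : Fin s, f t.succ = v) ↔ v ∈ e.erase (f 0) := by
    intro v
    rw [← Finset.mem_val, ← Multiset.mem_nsmul_of_ne_zero hs, ← h1]
    simp
  ext v
  simp only [Finset.mem_image, Finset.mem_univ, true_and, Fin.exists_fin_succ, key,
    Finset.mem_erase]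
  by_cases hv : v = f 0
  · subst hv; simp [h0]
  · simp [hv, Ne.symm hv]

theorem adjacencyTensor_eq {V : Type*} [Fintype V] [DecidableEq V] (H : Hypergraph V)
    (hcard : ∀ e ∈ H.edges, 2 ≤ e.card) {e : Finset V} (he : e ∈ H.edges)
    {f : Fin (H.s + 1) → V} (hf : IsIndexSeq e f) :
    H.adjacencyTensor f =
      ((Nat.factorial (H.s / (e.card - 1)) : ℝ) ^ (e.card - 1)) / (Nat.factorial H.s : ℝ) := by
  have hne : ∀ e' ∈ H.edges, H.s / (e'.card - 1) ≠ 0 := fun e' he' =>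
    (Nat.div_pos (Nat.le_of_dvd (H.s_pos hcard) (H.dvd_s he'))
      (by have := hcard e' he'; omega)).ne'
  unfold adjacencyTensor
  rw [Finset.sum_eq_single e]
  · simp [hf]
  · intro e' he' hee'
    rw [if_neg]
    intro hf'
    exact hee' ((hf'.eq_image (hne e' he')).trans (hf.eq_image (hne e he)).symm)
  · exact fun h => absurd he h

theorem adjacencyTensor_eq_zero {V : Type*} [Fintype V] [DecidableEq V] (H : Hypergraph V)
    {f : Fin (H.s + 1) → V} (hf : ∀ e ∈ H.edges, ¬ IsIndexSeq e f) :
    H.adjacencyTensor f = 0 :=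
  Finset.sum_eq_zero fun e he => if_neg (hf e he)

end Hypergraph

/-! Each index sequence of a hyperedge `e` through `i` gives the same monomial, and their number is
a multinomial coefficient that cancels the tensor entry. So the tensor acts as `edgePoly`, a sum
over the hyperedges through `i` (`apply_adjacencyTensor`), and both forms of the eigenvector
equation become `F_i(y) = λ y_i ^ s`, where `F` is monotone and homogeneous of degree `s`.

The rest is Perron–Frobenius theory. Connectedness makes the Collatz–Wielandt infimum of `max_i
F_i(x) / x_i ^ s` over positive `x` an attained minimum `λ` (`exists_collatzWielandt_min`). Among
its minimizers take one whose set of tight vertices (those with `F_i = λ x_i ^ s`) is minimal. That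
set is nonempty; if it were not everything, `exists_fewer_tight` would shrink it. So this minimizer
is an eigenvector. Comparing another vector with it at a vertex of maximal ratio gives uniqueness up
to scaling and, via absolute values, `|μ| ≤ λ` for every complex eigenvalue. -/

/-- The number of `n`-tuples with a given multiset of entries is a multinomial coefficient. -/
theorem Multiset.card_filter_map_univ_eq {V : Type*} [Fintype V] [DecidableEq V] {n : ℕ}
    (M : Multiset V) (hM : M.card = n) :
    ((Finset.univ : Finset (Fin n → V)).filter
      fun f => (Finset.univ : Finset (Fin n)).val.map f = M).card = M.toFinsupp.multinomial := by
  -- Compare two expressions for one coefficient of `(∑ X_v) ^ n`: the multinomial one, and the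
  -- count of tuples after full expansion.
  have h := MvPolynomial.coeff_sum_X_pow_of_fintype (R := ℕ) M.toFinsupp n
  have hsum : (M.toFinsupp.sum fun _ m => m) = n := by
    rw [← hM]; exact Multiset.toFinsupp_sum_eq M
  rw [if_pos hsum, Fintype.sum_pow, MvPolynomial.coeff_sum] at h
  have hmon : ∀ f : Fin n → V, (∏ t, (MvPolynomial.X (f t) : MvPolynomial V ℕ)) =
      MvPolynomial.monomial
        (Multiset.toFinsupp ((Finset.univ : Finset (Fin n)).val.map f)) 1 := by
    intro f
    have : Multiset.toFinsupp ((Finset.univ : Finset (Fin n)).val.map f) =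
        ∑ t, Finsupp.single (f t) 1 := by
      rw [← Multiset.sum_map_singleton ((Finset.univ : Finset (Fin n)).val.map f),
        Multiset.map_map, map_multiset_sum, Multiset.map_map]
      simp only [Function.comp_def, Multiset.toFinsupp_singleton]
      rfl
    rw [this, MvPolynomial.monomial_sum_one]
    rfl
  simp only [hmon, MvPolynomial.coeff_monomial, Multiset.toFinsupp.injective.eq_iff] at h
  rw [Finset.card_filter, h, Nat.cast_id]

namespace Hypergraph

/-! ### The tensor map as a sum over hyperedges -/

theorem one_le_s_div {V : Type*} [Fintype V] (H : Hypergraph V)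
    (hcard : ∀ e ∈ H.edges, 2 ≤ e.card) {e : Finset V} (he : e ∈ H.edges) :
    1 ≤ H.s / (e.card - 1) :=
  Nat.div_pos (Nat.le_of_dvd (H.s_pos hcard) (H.dvd_s he)) (by have := hcard e he; omega)

theorem Adj.exists_edge {V : Type*} [Fintype V] {H : Hypergraph V} {i j : V} (h : H.Adj i j) :
    ∃ e ∈ H.edges, i ∈ e ∧ j ∈ e := by
  classical
  obtain ⟨e, he, hi, hj⟩ := h
  exact ⟨e.toFinset, (H.mem_edges _).2 (by simpa using he), by simpa using hi, by simpa using hj⟩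

variable {V : Type*} [Fintype V] [DecidableEq V] (H : Hypergraph V)

theorem factorial_pow_mul_card_isIndexSeq {e : Finset V}
    (he : e ∈ H.edges) {i : V} (hi : i ∈ e) :
    (H.s / (e.card - 1)).factorial ^ (e.card - 1) *
      ((Finset.univ : Finset (Fin H.s → V)).filter fun g =>
        (Finset.univ : Finset (Fin H.s)).val.map g =
          (H.s / (e.card - 1)) • (e.erase i).val).card = H.s.factorial := by
  set q := H.s / (e.card - 1)
  have hq : (e.card - 1) * q = H.s := Nat.mul_div_cancel' (H.dvd_s he)
  have hc : (e.erase i).card = e.card - 1 := Finset.card_erase_of_mem hi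
  have hM : (q • (e.erase i).val).card = H.s := by
    rw [Multiset.card_nsmul, Finset.card_val, hc, ← hq, mul_comm]
  rw [Multiset.card_filter_map_univ_eq _ hM]
  have hcount : ∀ v ∈ e.erase i, Multiset.toFinsupp (q • (e.erase i).val) v = q := by
    intro v hv
    rw [Multiset.toFinsupp_apply, Multiset.count_nsmul,
      Multiset.count_eq_one_of_mem (e.erase i).nodup hv, mul_one]
  have hsub : (Multiset.toFinsupp (q • (e.erase i).val)).support ⊆ e.erase i := by
    intro v hv
    rw [Multiset.toFinsupp_support, Multiset.mem_toFinset] at hv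
    exact Multiset.mem_of_mem_nsmul hv
  rw [Finsupp.multinomial_eq_of_support_subset hsub]
  have := Nat.multinomial_spec (e.erase i) (Multiset.toFinsupp (q • (e.erase i).val))
  rwa [Finset.prod_congr rfl fun v hv => by rw [hcount v hv],
    Finset.sum_congr rfl hcount, Finset.prod_const, Finset.sum_const, hc, smul_eq_mul, hq] at this

/-- The `i`-th component of the polynomial map of the adjacency tensor, as a sum over the
hyperedges that contain `i`. -/
noncomputable def edgePoly {R : Type*} [CommSemiring R] (x : V → R) (i : V) : R :=
  ∑ e ∈ H.edges.filter fun e => i ∈ e, (∏ j ∈ e.erase i, x j) ^ (H.s / (e.card - 1))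

/-- Stated over a general real algebra so that it serves real eigenvectors and complex eigenvalues
alike. -/
theorem apply_adjacencyTensor {R : Type*} [CommRing R] [Algebra ℝ R] (x : V → R) (i : V) :
    RealTensor.apply (fun f => algebraMap ℝ R (H.adjacencyTensor f)) x i = H.edgePoly x i := by
  classical
  simp only [RealTensor.apply, adjacencyTensor, map_sum, Finset.sum_mul]
  rw [Finset.sum_comm, edgePoly, Finset.sum_filter]
  refine Finset.sum_congr rfl fun e he => ?_
  set q := H.s / (e.card - 1)
  by_cases hi : i ∈ e
  swap
  · rw [if_neg hi]
    refine Finset.sum_eq_zero fun g _ => ?_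
    rw [if_neg (by simp [IsIndexSeq, hi]), map_zero, zero_mul]
  rw [if_pos hi]
  have hterm : ∀ g : Fin H.s → V,
      (algebraMap ℝ R (if IsIndexSeq e (Fin.cons i g : Fin (H.s + 1) → V) then
        (q.factorial : ℝ) ^ (e.card - 1) / (H.s.factorial : ℝ) else 0)) * ∏ t, x (g t) =
      if (Finset.univ : Finset (Fin H.s)).val.map g = q • (e.erase i).val then
        algebraMap ℝ R ((q.factorial : ℝ) ^ (e.card - 1) / (H.s.factorial : ℝ)) *
          (∏ j ∈ e.erase i, x j) ^ q else 0 := by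
    intro g
    have hiff : IsIndexSeq e (Fin.cons i g : Fin (H.s + 1) → V) ↔
        (Finset.univ : Finset (Fin H.s)).val.map g = q • (e.erase i).val := by
      simp [IsIndexSeq, hi, q]
    by_cases hg : (Finset.univ : Finset (Fin H.s)).val.map g = q • (e.erase i).val
    · rw [if_pos (hiff.2 hg), if_pos hg]
      congr 1
      have : ∏ t, x (g t) = (((Finset.univ : Finset (Fin H.s)).val.map g).map x).prod := by
        rw [Multiset.map_map]; rfl
      rw [this, hg, Multiset.map_nsmul, Multiset.prod_nsmul]
      rfl
    · rw [if_neg (fun h => hg (hiff.1 h)), if_neg hg, map_zero, zero_mul]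
  rw [Finset.sum_congr rfl fun g _ => hterm g, ← Finset.sum_filter, Finset.sum_const,
    nsmul_eq_mul, ← mul_assoc]
  have hN := H.factorial_pow_mul_card_isIndexSeq he hi
  have hN' : algebraMap ℝ R ((((Finset.univ : Finset (Fin H.s → V)).filter fun g =>
        (Finset.univ : Finset (Fin H.s)).val.map g = q • (e.erase i).val).card : ℝ) *
      ((q.factorial : ℝ) ^ (e.card - 1) / (H.s.factorial : ℝ))) = 1 := by
    rw [← map_one (algebraMap ℝ R)]
    congr 1
    rw [mul_div_assoc', div_eq_one_iff_eq (by positivity), mul_comm]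
    exact_mod_cast hN
  rw [map_mul, map_natCast] at hN'
  rw [hN', one_mul]

theorem tensorEigenEq_iff {lam : ℝ} {y : V → ℝ} :
    H.TensorEigenEq lam y ↔ ∀ i, H.edgePoly y i = lam * y i ^ H.s :=
  forall_congr' fun i => by rw [← H.apply_adjacencyTensor y i]; rfl

theorem centralityEq_iff (hcard : ∀ e ∈ H.edges, 2 ≤ e.card) {lam : ℝ} (hlam : lam ≠ 0)
    {y : V → ℝ} : H.CentralityEq lam y ↔ ∀ i, H.edgePoly y i = lam * y i ^ H.s := by
  refine forall_congr' fun i => ?_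
  have hsum : ∑ k ∈ Finset.Icc 2 H.rank, ∑ e ∈ H.edgesAt k i,
      (∏ j ∈ e.erase i, y j) ^ (H.s / (k - 1)) = H.edgePoly y i := by
    have hmaps : ∀ e ∈ H.edges.filter fun e => i ∈ e, e.card ∈ Finset.Icc 2 H.rank := by
      intro e he
      have he' := (Finset.mem_filter.1 he).1
      exact Finset.mem_Icc.2 ⟨hcard e he', Finset.le_sup (f := Finset.card) he'⟩
    -- Group the hyperedges through `i` by cardinality, which lies between 2 and the rank.
    rw [edgePoly, ← Finset.sum_fiberwise_of_maps_to hmaps]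
    refine Finset.sum_congr rfl fun k _ => ?_
    have : H.edgesAt k i = (H.edges.filter fun e => i ∈ e).filter fun e => e.card = k := by
      ext e; simp only [edgesAt, Finset.mem_filter]; tauto
    rw [this]
    refine Finset.sum_congr rfl fun e he => ?_
    rw [(Finset.mem_filter.1 he).2]
  rw [hsum, one_div, eq_comm, inv_mul_eq_iff_eq_mul₀ hlam]

/-! ### Homogeneity, monotonicity and bounds -/

theorem edgePoly_smul {R : Type*} [CommSemiring R] (c : R) (x : V → R) (i : V) :
    H.edgePoly (c • x) i = c ^ H.s * H.edgePoly x i := by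
  rw [edgePoly, edgePoly, Finset.mul_sum]
  refine Finset.sum_congr rfl fun e he => ?_
  obtain ⟨he, hi⟩ := Finset.mem_filter.1 he
  simp only [Pi.smul_apply, smul_eq_mul]
  rw [Finset.prod_mul_distrib, Finset.prod_const, Finset.card_erase_of_mem hi, mul_pow, ← pow_mul,
    Nat.mul_div_cancel' (H.dvd_s he)]

theorem edgePoly_mono {x y : V → ℝ} (hx : ∀ i, 0 ≤ x i) (hxy : ∀ i, x i ≤ y i) (i : V) :
    H.edgePoly x i ≤ H.edgePoly y i :=
  Finset.sum_le_sum fun _ _ => pow_le_pow_left₀ (Finset.prod_nonneg fun j _ => hx j)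
    (Finset.prod_le_prod (fun j _ => hx j) fun j _ => hxy j) _

theorem norm_edgePoly_le (x : V → ℂ) (i : V) :
    ‖H.edgePoly x i‖ ≤ H.edgePoly (fun j => ‖x j‖) i :=
  (norm_sum_le _ _).trans_eq (Finset.sum_congr rfl fun e _ => by rw [norm_pow, norm_prod])

/-- Strictness needs `x` positive everywhere: a vanishing factor in the shared hyperedge could hide
the increase at `j`. -/
theorem edgePoly_lt (hcard : ∀ e ∈ H.edges, 2 ≤ e.card) {x y : V → ℝ} (hx : ∀ i, 0 < x i)
    (hxy : ∀ i, x i ≤ y i) {i j : V} (hadj : H.Adj i j) (hij : i ≠ j) (hj : x j < y j) :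
    H.edgePoly x i < H.edgePoly y i := by
  obtain ⟨e, he, hie, hje⟩ := hadj.exists_edge
  refine Finset.sum_lt_sum (fun e _ => pow_le_pow_left₀ (Finset.prod_nonneg fun j _ => (hx j).le)
    (Finset.prod_le_prod (fun j _ => (hx j).le) fun j _ => hxy j) _)
    ⟨e, Finset.mem_filter.2 ⟨he, hie⟩, ?_⟩
  refine pow_lt_pow_left₀ ?_ (Finset.prod_nonneg fun j _ => (hx j).le)
    (Nat.one_le_iff_ne_zero.1 (H.one_le_s_div hcard he))
  exact Finset.prod_lt_prod (fun j _ => hx j) (fun j _ => hxy j)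
    ⟨j, Finset.mem_erase.2 ⟨hij.symm, hje⟩, hj⟩

theorem edgePoly_pos {x : V → ℝ} (hx : ∀ i, 0 < x i) {i j : V} (hadj : H.Adj i j) :
    0 < H.edgePoly x i := by
  obtain ⟨e, he, hie, -⟩ := hadj.exists_edge
  exact Finset.sum_pos (fun e _ => pow_pos (Finset.prod_pos fun j _ => hx j) _)
    ⟨e, Finset.mem_filter.2 ⟨he, hie⟩⟩

theorem le_edgePoly (hcard : ∀ e ∈ H.edges, 2 ≤ e.card) {x : V → ℝ} (hx : ∀ i, 1 ≤ x i)
    {i j : V} (hadj : H.Adj i j) (hij : i ≠ j) : x j ≤ H.edgePoly x i := by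
  obtain ⟨e, he, hie, hje⟩ := hadj.exists_edge
  have hx0 : ∀ i, 0 ≤ x i := fun i => zero_le_one.trans (hx i)
  have hprod : ∀ s : Finset V, 1 ≤ ∏ k ∈ s, x k := fun s =>
    Finset.one_le_prod fun k _ => hx k
  have hje' : j ∈ e.erase i := Finset.mem_erase.2 ⟨hij.symm, hje⟩
  calc x j ≤ x j * ∏ k ∈ (e.erase i).erase j, x k := le_mul_of_one_le_right (hx0 j) (hprod _)
    _ = ∏ k ∈ e.erase i, x k := Finset.mul_prod_erase _ _ hje'
    _ ≤ (∏ k ∈ e.erase i, x k) ^ (H.s / (e.card - 1)) :=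
      le_self_pow₀ (hprod _) (Nat.one_le_iff_ne_zero.1 (H.one_le_s_div hcard he))
    _ ≤ H.edgePoly x i :=
      Finset.single_le_sum (f := fun e => (∏ j ∈ e.erase i, x j) ^ (H.s / (e.card - 1)))
        (fun e _ => pow_nonneg (Finset.prod_nonneg fun j _ => hx0 j) _)
        (Finset.mem_filter.2 ⟨he, hie⟩)

theorem continuous_edgePoly (i : V) : Continuous fun x : V → ℝ => H.edgePoly x i := by
  unfold edgePoly
  fun_prop

/-- The factor at `j` is erased, so changing `x j` affects only the other side of the inequality at
`j`. -/
theorem edgePoly_update_self (x : V → ℝ) (j : V) (a : ℝ) :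
    H.edgePoly (Function.update x j a) j = H.edgePoly x j := by
  refine Finset.sum_congr rfl fun e _ => ?_
  rw [Finset.prod_congr rfl fun k hk => Function.update_of_ne (Finset.ne_of_mem_erase hk) _ _]

/-! ### Connectedness and the Collatz–Wielandt minimum -/

/-- In a connected hypergraph, a nonempty adjacency-closed set of vertices is everything. -/
theorem forall_of_adj_closed {V : Type*} {H : Hypergraph V}
    (hconn : ∀ i j, Relation.ReflTransGen H.Adj i j) {p : V → Prop} {i : V} (hi : p i)
    (h : ∀ i j, p i → H.Adj i j → i ≠ j → p j) (j : V) : p j := by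
  induction hconn i j with
  | refl => exact hi
  | @tail b c _ hbc ih =>
    by_cases hne : b = c
    · exact hne ▸ ih
    · exact h b c ih hbc hne

/-- Bounds spread along adjacency: if `x k ≤ C`, a neighbour satisfies `x j ≤ F_k(x) ≤ M x_k ^ s ≤
|M| C ^ s`. This supplies the compactness for the minimum. -/
theorem exists_bound (hcard : ∀ e ∈ H.edges, 2 ≤ e.card)
    (hconn : ∀ i j, Relation.ReflTransGen H.Adj i j) (M : ℝ) :
    ∃ C, ∀ x : V → ℝ, (∀ i, 1 ≤ x i) → (∃ i, x i = 1) →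
      (∀ i, H.edgePoly x i ≤ M * x i ^ H.s) → ∀ j, x j ≤ C := by
  have key : ∀ i j, ∃ C, ∀ x : V → ℝ, (∀ i, 1 ≤ x i) → x i = 1 →
      (∀ i, H.edgePoly x i ≤ M * x i ^ H.s) → x j ≤ C := by
    intro i
    refine forall_of_adj_closed hconn (i := i) ⟨1, fun x _ h _ => h.le⟩ ?_
    rintro k j ⟨C, hC⟩ hadj hkj
    refine ⟨|M| * C ^ H.s, fun x h1 hi hM => ?_⟩
    calc x j ≤ H.edgePoly x k := H.le_edgePoly hcard h1 hadj hkj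
      _ ≤ M * x k ^ H.s := hM k
      _ ≤ |M| * x k ^ H.s := by
        gcongr
        · exact pow_nonneg (zero_le_one.trans (h1 k)) _
        · exact le_abs_self M
      _ ≤ |M| * C ^ H.s := by
        gcongr
        · exact zero_le_one.trans (h1 k)
        · exact hC x h1 hi hM
  choose C hC using key
  refine ⟨∑ i, ∑ j, |C i j|, fun x h1 ⟨i, hi⟩ hM j => ?_⟩
  calc x j ≤ C i j := hC i j x h1 hi hM
    _ ≤ |C i j| := le_abs_self _
    _ ≤ ∑ j, |C i j| :=
      Finset.single_le_sum (f := fun j => |C i j|) (fun _ _ => abs_nonneg _) (Finset.mem_univ j)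
    _ ≤ ∑ i, ∑ j, |C i j| :=
      Finset.single_le_sum (f := fun i => ∑ j, |C i j|)
        (fun _ _ => Finset.sum_nonneg fun _ _ => abs_nonneg _) (Finset.mem_univ i)

/-- The Collatz–Wielandt minimum over positive vectors is attained. -/
theorem exists_collatzWielandt_min [Nonempty V] (hcard : ∀ e ∈ H.edges, 2 ≤ e.card)
    (hconn : ∀ i j, Relation.ReflTransGen H.Adj i j) :
    ∃ lam : ℝ, (∃ u : V → ℝ, (∀ i, 0 < u i) ∧ ∀ i, H.edgePoly u i ≤ lam * u i ^ H.s) ∧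
      ∀ x : V → ℝ, (∀ i, 0 < x i) → ∃ i, lam * x i ^ H.s ≤ H.edgePoly x i := by
  let φ : (V → ℝ) → ℝ := fun x =>
    Finset.univ.sup' Finset.univ_nonempty fun i => H.edgePoly x i / x i ^ H.s
  have hφle : ∀ x : V → ℝ, (∀ i, 0 < x i) → ∀ i, H.edgePoly x i ≤ φ x * x i ^ H.s := by
    intro x hx i
    rw [← div_le_iff₀ (pow_pos (hx i) _)]
    exact Finset.le_sup' (fun i => H.edgePoly x i / x i ^ H.s) (Finset.mem_univ i)
  have hφeq : ∀ x : V → ℝ, (∀ i, 0 < x i) → ∃ i, φ x * x i ^ H.s = H.edgePoly x i := by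
    intro x hx
    obtain ⟨i, -, hi⟩ := Finset.exists_mem_eq_sup' Finset.univ_nonempty
      fun i => H.edgePoly x i / x i ^ H.s
    exact ⟨i, by rw [← eq_div_iff (pow_pos (hx i) _).ne']; exact hi⟩
  -- Only vectors doing at least as well as the constant vector `1` compete, which fixes the level
  -- `φ 1`; the `max` below keeps `1` in the box `K`.
  obtain ⟨C, hC⟩ := H.exists_bound hcard hconn (φ 1)
  let K : Set (V → ℝ) := Set.pi Set.univ fun _ => Set.Icc 1 (max C 1)
  have hKpos : ∀ x ∈ K, ∀ i, 0 < x i := fun x hx i =>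
    zero_lt_one.trans_le (hx i (Set.mem_univ i)).1
  have h1K : (1 : V → ℝ) ∈ K := fun i _ => ⟨le_rfl, le_max_right _ _⟩
  have hcont : ContinuousOn φ K := by
    refine ContinuousOn.finset_sup'_apply _ fun i _ => ?_
    exact (H.continuous_edgePoly i).continuousOn.div
      ((continuous_apply i).pow _).continuousOn fun x hx => (pow_pos (hKpos x hx i) _).ne'
  obtain ⟨u, huK, hu⟩ := (isCompact_univ_pi fun _ => isCompact_Icc).exists_isMinOn ⟨1, h1K⟩ hcont
  refine ⟨φ u, ⟨u, hKpos u huK, hφle u (hKpos u huK)⟩, fun x hx => ?_⟩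
  obtain ⟨k, hk⟩ := Finite.exists_min x
  -- Scale the smallest coordinate to 1. Then either `φ z ≥ φ 1 ≥ φ u`, or `z` lies in `K`.
  set z : V → ℝ := (x k)⁻¹ • x
  have hz : ∀ i, z i = (x k)⁻¹ * x i := fun i => rfl
  have hz1 : ∀ i, 1 ≤ z i := fun i => by
    rw [hz, ← inv_mul_cancel₀ (hx k).ne']
    exact mul_le_mul_of_nonneg_left (hk i) (inv_nonneg.2 (hx k).le)
  have hz0 : ∀ i, 0 < z i := fun i => zero_lt_one.trans_le (hz1 i)
  have hmin : φ u ≤ φ z := by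
    rcases le_total (φ 1) (φ z) with h | h
    · exact (hu h1K).trans h
    · refine hu fun j _ => ⟨hz1 j, le_max_of_le_left ?_⟩
      refine hC z hz1 ⟨k, inv_mul_cancel₀ (hx k).ne'⟩ (fun i => (hφle z hz0 i).trans ?_) j
      exact mul_le_mul_of_nonneg_right h (pow_nonneg (hz0 i).le _)
  obtain ⟨i, hi⟩ := hφeq z hz0
  refine ⟨i, ?_⟩
  have hle : φ u * z i ^ H.s ≤ H.edgePoly z i :=
    (mul_le_mul_of_nonneg_right hmin (pow_nonneg (hz0 i).le _)).trans_eq hi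
  rw [H.edgePoly_smul, hz, mul_pow, mul_left_comm] at hle
  exact le_of_mul_le_mul_left hle (pow_pos (inv_pos.2 (hx k)) _)

/-! ### The positive eigenvector: existence -/

/-- A sub-eigenvector that is tight at `i` but not at the adjacent vertex `j` can be shrunk at `j`
to one that is tight at fewer vertices. -/
theorem exists_fewer_tight (hcard : ∀ e ∈ H.edges, 2 ≤ e.card) {lam : ℝ}
    {u : V → ℝ} (hu : ∀ i, 0 < u i) (hle : ∀ i, H.edgePoly u i ≤ lam * u i ^ H.s) {i j : V}
    (hi : H.edgePoly u i = lam * u i ^ H.s) (hj : H.edgePoly u j ≠ lam * u j ^ H.s)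
    (hadj : H.Adj i j) :
    ∃ v : V → ℝ, (∀ i, 0 < v i) ∧ (∀ i, H.edgePoly v i ≤ lam * v i ^ H.s) ∧
      (Finset.univ.filter fun k => H.edgePoly v k = lam * v k ^ H.s) ⊂
        Finset.univ.filter fun k => H.edgePoly u k = lam * u k ^ H.s := by
  have hij : i ≠ j := fun h => hj (h ▸ hi)
  have hjlt : H.edgePoly u j < lam * u j ^ H.s := lt_of_le_of_ne (hle j) hj
  -- By continuity the slack at `j` survives a small decrease of `u j`; that decrease makes the
  -- neighbour `i` slack too.
  obtain ⟨a, haj, ha0, ha⟩ : ∃ a, a < u j ∧ 0 < a ∧ H.edgePoly u j < lam * a ^ H.s := by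
    have hc : Filter.Tendsto (fun a : ℝ => lam * a ^ H.s) (nhdsWithin (u j) (Set.Iio (u j)))
        (nhds (lam * u j ^ H.s)) :=
      (Continuous.tendsto (by fun_prop) _).mono_left nhdsWithin_le_nhds
    have h1 := hc.eventually (lt_mem_nhds hjlt)
    have h2 : ∀ᶠ a in nhdsWithin (u j) (Set.Iio (u j)), 0 < a :=
      nhdsWithin_le_nhds (lt_mem_nhds (hu j))
    obtain ⟨a, ⟨h1, h2⟩, h3⟩ := ((h1.and h2).and self_mem_nhdsWithin).exists
    exact ⟨a, h3, h2, h1⟩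
  set v := Function.update u j a
  have hvj : v j = a := Function.update_self _ _ _
  have hvk : ∀ k, k ≠ j → v k = u k := fun k hk => Function.update_of_ne hk _ _
  have hv0 : ∀ k, 0 < v k := fun k => by
    by_cases hk : k = j
    · rw [hk, hvj]; exact ha0
    · rw [hvk k hk]; exact hu k
  have hvu : ∀ k, v k ≤ u k := fun k => by
    by_cases hk : k = j
    · rw [hk, hvj]; exact haj.le
    · rw [hvk k hk]
  have hlt : H.edgePoly v j < lam * v j ^ H.s := by
    rw [hvj, H.edgePoly_update_self]; exact ha
  have hmono : ∀ k, H.edgePoly v k ≤ H.edgePoly u k := H.edgePoly_mono (fun k => (hv0 k).le) hvu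
  refine ⟨v, hv0, fun k => ?_, ?_⟩
  · by_cases hk : k = j
    · rw [hk]; exact hlt.le
    · rw [hvk k hk]; exact (hmono k).trans (hle k)
  · rw [Finset.ssubset_iff_of_subset]
    · refine ⟨i, by simpa using hi, ?_⟩
      have := H.edgePoly_lt hcard hv0 hvu hadj hij (hvj ▸ haj)
      rw [Finset.mem_filter, hvk i hij, ← hi]
      exact fun h => this.ne h.2
    · intro k hk
      have hk := (Finset.mem_filter.1 hk).2
      have hkj : k ≠ j := fun h => hlt.ne (h ▸ hk)
      rw [hvk k hkj] at hk
      exact Finset.mem_filter.2 ⟨Finset.mem_univ k, (hle k).antisymm (hk ▸ hmono k)⟩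

theorem exists_pos_eigenvector [Nontrivial V] (hcard : ∀ e ∈ H.edges, 2 ≤ e.card)
    (hconn : ∀ i j, Relation.ReflTransGen H.Adj i j) :
    ∃ lam : ℝ, 0 < lam ∧ ∃ y : V → ℝ, (∀ i, 0 < y i) ∧
      ∀ i, H.edgePoly y i = lam * y i ^ H.s := by
  obtain ⟨lam, ⟨u, hu, hle⟩, hmin⟩ := H.exists_collatzWielandt_min hcard hconn
  have hlam : 0 < lam := by
    obtain ⟨i, j, hij⟩ := exists_pair_ne V
    obtain h | ⟨k, hik, -⟩ := Relation.ReflTransGen.cases_head (hconn i j)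
    · exact absurd h hij
    · exact pos_of_mul_pos_left ((H.edgePoly_pos hu hik).trans_le (hle i)) (pow_pos (hu i) _).le
  refine ⟨lam, hlam, ?_⟩
  -- Minimality refers to inclusion of the finite sets of tight vertices.
  obtain ⟨v, ⟨hv, hvle⟩, hvmin⟩ := exists_minimalFor_of_wellFoundedLT
    (fun u : V → ℝ => (∀ i, 0 < u i) ∧ ∀ i, H.edgePoly u i ≤ lam * u i ^ H.s)
    (fun u => (Finset.univ.filter fun k => H.edgePoly u k = lam * u k ^ H.s)) ⟨u, hu, hle⟩
  obtain ⟨i, hi⟩ := hmin v hv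
  refine ⟨v, hv, forall_of_adj_closed hconn ((hvle i).antisymm hi) fun i j hi hadj _ => ?_⟩
  by_contra hj
  obtain ⟨w, hw, hwle, hlt⟩ := H.exists_fewer_tight hcard hv hvle hi hj hadj
  exact hlt.not_ge (hvmin ⟨hw, hwle⟩ hlt.le)

/-! ### Maximal ratios: uniqueness and the spectral radius -/

theorem exists_ratio_max {V : Type*} [Finite V] [Nonempty V] (x : V → ℝ) {y : V → ℝ} (hy : ∀ i, 0 < y i) :
    ∃ c i, x i = c * y i ∧ ∀ j, x j ≤ c * y j := by
  obtain ⟨i, hi⟩ := Finite.exists_max fun j => x j / y j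
  exact ⟨x i / y i, i, (div_mul_cancel₀ _ (hy i).ne').symm, fun j => (div_le_iff₀ (hy j)).1 (hi j)⟩

/-- Let `c` be the largest ratio `z_i / y_i`. Where it is attained, `F_i(z)` and `F_i(c y)` both
equal `λ z_i ^ s`, so no neighbour can have `z_j < c y_j`; equality spreads by connectedness. -/
theorem eq_smul_of_pos_eigenvector [Nonempty V] (hcard : ∀ e ∈ H.edges, 2 ≤ e.card)
    (hconn : ∀ i j, Relation.ReflTransGen H.Adj i j) {lam : ℝ} {y z : V → ℝ}
    (hy : ∀ i, 0 < y i) (hye : ∀ i, H.edgePoly y i = lam * y i ^ H.s)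
    (hz : ∀ i, 0 < z i) (hze : ∀ i, H.edgePoly z i = lam * z i ^ H.s) :
    ∃ c : ℝ, 0 < c ∧ z = c • y := by
  obtain ⟨c, i, hi, hle⟩ := exists_ratio_max z hy
  refine ⟨c, pos_of_mul_pos_left (hi ▸ hz i) (hy i).le, funext ?_⟩
  refine forall_of_adj_closed hconn (p := fun i => z i = (c • y) i) hi fun i j hi hadj hij => ?_
  by_contra hj
  have := H.edgePoly_lt hcard hz (y := c • y) hle hadj hij (lt_of_le_of_ne (hle j) hj)
  rw [H.edgePoly_smul, hze, hye, hi, Pi.smul_apply, smul_eq_mul, mul_pow, mul_left_comm] at this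
  exact this.ne rfl

theorem mem_eigenvalues_iff {μ : ℂ} : μ ∈ RealTensor.eigenvalues H.adjacencyTensor ↔
    ∃ x : V → ℂ, x ≠ 0 ∧ ∀ i, H.edgePoly x i = μ * x i ^ H.s :=
  exists_congr fun x => and_congr_right fun _ => forall_congr' fun i => by
    rw [← H.apply_adjacencyTensor x i]; rfl

theorem isGreatest_eigenvalueModuli [Nonempty V] {lam : ℝ} (hlam : 0 < lam) {y : V → ℝ}
    (hy : ∀ i, 0 < y i) (hye : ∀ i, H.edgePoly y i = lam * y i ^ H.s) :
    IsGreatest (RealTensor.eigenvalueModuli H.adjacencyTensor) lam := by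
  constructor
  · refine ⟨(lam : ℂ), H.mem_eigenvalues_iff.2 ⟨fun i => (y i : ℂ), fun h => ?_, fun i => ?_⟩, ?_⟩
    · obtain ⟨i⟩ := ‹Nonempty V›
      exact (hy i).ne' (Complex.ofReal_eq_zero.1 (congrFun h i))
    · have := congrArg (fun r : ℝ => (r : ℂ)) (hye i)
      simpa [edgePoly] using this
    · simpa using hlam.le
  · rintro _ ⟨μ, hμ, rfl⟩
    obtain ⟨x, hx, hxe⟩ := H.mem_eigenvalues_iff.1 hμ
    obtain ⟨c, i, hi, hle⟩ := exists_ratio_max (fun j => ‖x j‖) hy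
    -- A nonzero coordinate of `x` forces `c > 0`, so `‖x i‖ ^ s` can be cancelled at the end.
    have hxi : 0 < ‖x i‖ := by
      obtain ⟨j, hj⟩ := Function.ne_iff.1 hx
      have hc := pos_of_mul_pos_left ((norm_pos_iff.2 hj).trans_le (hle j)) (hy j).le
      rw [hi]; exact mul_pos hc (hy i)
    have h : ‖μ‖ * ‖x i‖ ^ H.s ≤ lam * ‖x i‖ ^ H.s :=
      calc ‖μ‖ * ‖x i‖ ^ H.s = ‖H.edgePoly x i‖ := by rw [hxe, norm_mul, norm_pow]
        _ ≤ H.edgePoly (fun j => ‖x j‖) i := H.norm_edgePoly_le x i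
        _ ≤ H.edgePoly (c • y) i := H.edgePoly_mono (fun _ => norm_nonneg _) hle i
        _ = lam * ‖x i‖ ^ H.s := by rw [H.edgePoly_smul, hye, hi, mul_pow, mul_left_comm]
    exact le_of_mul_le_mul_right h (pow_pos hxi _)

theorem isHEC_iff {y : V → ℝ} : H.IsHEC y ↔ (∀ i, 0 < y i) ∧
    (∀ i, H.edgePoly y i = RealTensor.spectralRadius H.adjacencyTensor * y i ^ H.s) ∧
    ∑ i, y i ^ (H.s + 1) = 1 := by
  rw [IsHEC, tensorEigenEq_iff]
  refine and_congr_right fun hy => and_congr_right fun _ => ?_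
  simp only [abs_of_pos (hy _)]
  have h0 : 0 ≤ ∑ i, y i ^ (H.s + 1) := Finset.sum_nonneg fun i _ => pow_nonneg (hy i).le _
  rw [← Real.rpow_left_inj h0 zero_le_one (z := 1 / ((H.s : ℝ) + 1)) (by positivity), Real.one_rpow]

end Hypergraph

theorem theorem3p2 {V : Type*} [Fintype V] [DecidableEq V] (H : Hypergraph V)
    (hV : H.vertexSet = Set.univ)
    (hE : H.edgeSet.Nonempty)
    (hcard : ∀ e ∈ H.edgeSet, 2 ≤ e.ncard)
    (hconn : H.IsConnected) :
    -- the spectral radius is a maximum, and it is positive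
    IsGreatest (RealTensor.eigenvalueModuli H.adjacencyTensor)
        (RealTensor.spectralRadius H.adjacencyTensor) ∧
      0 < RealTensor.spectralRadius H.adjacencyTensor ∧
      -- existence and uniqueness, up to scaling, of the positive solution
      (∃ y : V → ℝ, (∀ i, 0 < y i) ∧
        H.CentralityEq (RealTensor.spectralRadius H.adjacencyTensor) y ∧
        ∀ z : V → ℝ, (∀ i, 0 < z i) →
          (H.CentralityEq (RealTensor.spectralRadius H.adjacencyTensor) z ↔
            ∃ c : ℝ, 0 < c ∧ z = c • y)) ∧
      -- the system is the eigenvector equation of the adjacency tensor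
      (∀ y : V → ℝ,
        H.CentralityEq (RealTensor.spectralRadius H.adjacencyTensor) y ↔
          H.TensorEigenEq (RealTensor.spectralRadius H.adjacencyTensor) y) ∧
      -- the hypergraph eigenvector centrality is well defined
      (∃! y : V → ℝ, H.IsHEC y) := by
  have hcard' : ∀ e ∈ H.edges, 2 ≤ e.card := fun e he => by
    simpa using hcard _ ((H.mem_edges e).1 he)
  have hconn' : ∀ i j, Relation.ReflTransGen H.Adj i j := fun i j =>
    hconn.2 i (hV ▸ Set.mem_univ i) j (hV ▸ Set.mem_univ j)
  have : Nontrivial V := by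
    obtain ⟨e, he⟩ := hE
    obtain ⟨a, -, b, -, hab⟩ := Set.one_lt_ncard_iff_nontrivial.1 (hcard e he)
    exact ⟨a, b, hab⟩
  obtain ⟨lam, hlam, y, hy, hye⟩ := H.exists_pos_eigenvector hcard' hconn'
  have hgreat := H.isGreatest_eigenvalueModuli hlam hy hye
  have hrho : RealTensor.spectralRadius H.adjacencyTensor = lam := hgreat.csSup_eq
  have hsmul : ∀ c : ℝ, ∀ i, H.edgePoly (c • y) i = lam * (c • y) i ^ H.s := fun c i => by
    rw [H.edgePoly_smul, hye, Pi.smul_apply, smul_eq_mul, mul_pow, mul_left_comm]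
  simp only [H.isHEC_iff, hrho, H.centralityEq_iff hcard' hlam.ne', H.tensorEigenEq_iff]
  refine ⟨hgreat, hlam, ⟨y, hy, hye, fun z hz =>
    ⟨H.eq_smul_of_pos_eigenvector hcard' hconn' hy hye hz, ?_⟩⟩, fun _ => trivial, ?_⟩
  · rintro ⟨c, -, rfl⟩
    exact hsmul c
  have hnorm : ∀ c : ℝ, ∑ i, (c • y) i ^ (H.s + 1) =
      c ^ (H.s + 1) * ∑ i, y i ^ (H.s + 1) := fun c => by
    simp only [Pi.smul_apply, smul_eq_mul, mul_pow, Finset.mul_sum]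
  have hS : 0 < ∑ i, y i ^ (H.s + 1) :=
    Finset.sum_pos (fun i _ => pow_pos (hy i) _) Finset.univ_nonempty
  set S := ∑ i, y i ^ (H.s + 1)
  obtain ⟨c, hc, hcS⟩ : ∃ c : ℝ, 0 < c ∧ c ^ (H.s + 1) = S⁻¹ :=
    -- Scaling by `c` multiplies the power sum `S` by `c ^ (s + 1)`, so this root normalizes it to
    -- 1.
    ⟨S⁻¹ ^ (((H.s + 1 : ℕ) : ℝ)⁻¹), Real.rpow_pos_of_pos (inv_pos.2 hS) _,
      Real.rpow_inv_natCast_pow (inv_pos.2 hS).le (Nat.succ_ne_zero _)⟩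
  refine ⟨c • y, ⟨fun i => mul_pos hc (hy i), hsmul c, ?_⟩, ?_⟩
  · rw [hnorm, hcS, inv_mul_cancel₀ hS.ne']
  · rintro z ⟨hz, hze, hz1⟩
    obtain ⟨d, hd, rfl⟩ := H.eq_smul_of_pos_eigenvector hcard' hconn' hy hye hz hze
    rw [hnorm, ← eq_div_iff hS.ne', one_div, ← hcS] at hz1
    rw [(pow_left_inj₀ hd.le hc.le (Nat.succ_ne_zero _)).1 hz1]
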